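/- Let $X$ be a $\sigma$-compact topological space with its Borel $\sigma$-algebra, let $\lambda$ be a Borel probability measure on $X$, and let $f:X\to X$ be a measurable map for which $\lambda$ is quasi-invariant, i.e. $f_*\lambda\ll\lambda$. Assume that $f$ is ergodic with respect to $\lambda$ (every measurable $A$ with $f^{-1}(A)=A$ satisfies $\lambda(A)=0$ or $\lambda(X\setminus A)=0$) and conservative with respect to $\lambda$ (for every measurable $A$ with $\lambda(A)>0$ there are $x\in A$ and $n\ge1$ with $f^n(x)\in A$). A $\lambda$-partition of $X$ is a countable collection $\mathcal G$ of pairwise disjoint $\sigma$-compact Borel sets $I$ with $0<\lambda(I)<\infty$ and $\lambda\bigl(X\setminus\bigcup_{I\in\mathcal G}I\bigr)=0$. For such $\mathcal G$, let $\mathcal M(\mathcal G,f)$ be the set of $\sigma$-finite Borel measures $\mu$ on $X$ such that for every $I\in\mathcal G$ there is a $K>0$ with 1. $\frac1K\le\mu(I)\le K$; and 2. for every $n\ge0$, $0<\mu(f^{-n}(I))<\infty$, and for every measurable $A\subset I$ $$\frac1K\,\frac{\lambda(A)}{\lambda(I)}\le\frac{\mu(f^{-n}(A))}{\mu(f^{-n}(I))}\le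 K\,\frac{\lambda(A)}{\lambda(I)}.$$ **Theorem.** If there is a $\lambda$-partition $\mathcal G$ of $X$ with $\lambda\in\mathcal M(\mathcal G,f)$, then $f$ has a $\sigma$-finite absolutely continuous invariant measure: there is a nonzero $\sigma$-finite Borel measure $\nu$ on $X$ with $\nu\ll\lambda$ and $f_*\nu=\nu$. -/

import Mathlib

namespace Acim

open MeasureTheory

variable {X : Type*} [MeasurableSpace X]

/-- A `lam`-partition of `X`: a countable (finite or infinite) collection of pairwise disjoint
Borel sets, each `σ`-compact and of positive finite `lam`-measure, covering `X` up to a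
`lam`-null set. -/
structure IsLambdaPartition [TopologicalSpace X] (lam : Measure X) (G : Set (Set X)) : Prop where
  countable : G.Countable
  pairwiseDisjoint : ∀ I ∈ G, ∀ J ∈ G, I ≠ J → Disjoint I J
  measurableSet : ∀ I ∈ G, MeasurableSet I
  isSigmaCompact : ∀ I ∈ G, IsSigmaCompact I
  pos : ∀ I ∈ G, 0 < lam I
  lt_top : ∀ I ∈ G, lam I < ⊤
  null_compl : lam (⋃₀ G)ᶜ = 0

/-- The derivative of `mu` with respect to `lam` has distortion bounded by `K` on `I`
(used for sets `I` with `lam I` and `mu I` positive and finite). -/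
def DistortionBoundedBy (lam mu : Measure X) (I : Set X) (K : ℝ) : Prop :=
  ∀ A : Set X, MeasurableSet A → A ⊆ I →
    (1 / K) * (lam.real A / lam.real I) ≤ mu.real A / mu.real I ∧
      mu.real A / mu.real I ≤ K * (lam.real A / lam.real I)

/-- `mu I ∈ [1/K, K]`. -/
def CondM1 (mu : Measure X) (I : Set X) (K : ℝ) : Prop :=
  mu I ≠ ⊤ ∧ 1 / K ≤ mu.real I ∧ mu.real I ≤ K

/-- For every `n`, the set `f⁻ⁿ(I)` has positive finite `mu`-measure, and the derivative of
`fⁿ_* mu` with respect to `lam` has distortion bounded by `K` on `I`. -/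
def CondM2 (lam : Measure X) (f : X → X) (mu : Measure X) (I : Set X) (K : ℝ) : Prop :=
  ∀ n : ℕ, 0 < mu (f^[n] ⁻¹' I) ∧ mu (f^[n] ⁻¹' I) < ⊤ ∧
    DistortionBoundedBy lam (mu.map f^[n]) I K

/-- The space `𝓜(G, f)` of `σ`-finite measures `mu` such that, for every `I ∈ G`, the measures
`fⁿ_* mu` have uniformly (in `n`) bounded distortion on `I`. -/
def measureClass (lam : Measure X) (G : Set (Set X)) (f : X → X) : Set (Measure X) :=
  {mu | SigmaFinite mu ∧ ∀ I ∈ G, ∃ K : ℝ, 0 < K ∧ CondM1 mu I K ∧ CondM2 lam f mu I K}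

end Acim

open MeasureTheory Filter Topology Set
open scoped ENNReal NNReal

namespace Acim

/-! ### Recurrence, and from superinvariance to invariance. -/

section Recurrence

variable {X : Type*} [MeasurableSpace X] {lam : Measure X} {f : X → X}

/-! Fix `I ∈ G` and normalise the sums `S N` of the first `N` push-forwards of `lam` by `S N I`.
Ergodicity sends a positive part of each `J ∈ G` into `I` at some fixed time, so bounded distortion
on `J` dominates the normalised sums there by a multiple of `lam` independent of `N`
(`exists_iterateSum_le`). Hence they converge setwise on each `J` along an ultrafilter
(`exists_measure_tendsto_of_le`). The sum of these local limits is absolutely continuous and gives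
`I` mass 1, but mass may escape through the infinitely many `J`, so it is only superinvariant
(`exists_superinvariant`). Conservativity removes the defect: pulled back along the iterates, a
nonzero defect would have infinite total mass inside a finite budget (`map_eq_of_map_le`). -/

/-- A measure absolutely continuous with respect to a conservative one gives infinite total mass
to the preimages of any set that it charges. -/
theorem tsum_measure_preimage_iterate_eq_top (hcons : Conservative f lam) {d : Measure X}
    (hd : d ≪ lam) {A : Set X} (hA : MeasurableSet A) (h0 : d A ≠ 0) :
    ∑' n, d (f^[n] ⁻¹' A) = ⊤ := by
  by_contra h
  -- Borel–Cantelli: a finite sum contradicts infinitely many returns to `A`.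
  have h1 := measure_limsup_atTop_eq_zero h
  refine h0 (measure_mono_null_ae ?_ h1)
  filter_upwards [hd.ae_le (hcons.ae_mem_imp_frequently_image_mem hA.nullMeasurableSet)]
    with x hx hxA
  exact mem_limsup_iff_frequently_mem.2 (hx hxA)

/-- For a conservative ergodic map, almost every orbit visits any given set of positive measure. -/
theorem ae_exists_iterate_mem (hcons : Conservative f lam) (herg : QuasiErgodic f lam)
    {A : Set X} (hA : MeasurableSet A) (h0 : lam A ≠ 0) :
    ∀ᵐ x ∂lam, ∃ n, f^[n] x ∈ A := by
  set L : Set X := limsup (fun n => f^[n] ⁻¹' A) atTop with hL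
  have hLm : MeasurableSet L :=
    MeasurableSet.measurableSet_limsup fun n => hcons.measurable.iterate n hA
  have hLi : f ⁻¹' L = L := by
    ext x
    simp only [hL, mem_preimage, mem_limsup_iff_frequently_mem, ← Function.iterate_succ_apply]
    conv_rhs => rw [← map_add_atTop_eq_nat 1, frequently_map]
  rcases herg.toPreErgodic.ae_mem_or_ae_notMem hLm hLi with h | h
  · filter_upwards [h] with x hx
    exact (mem_limsup_iff_frequently_mem.1 hx).exists
  · refine absurd ?_ h0
    rw [measure_eq_zero_iff_ae_notMem]
    filter_upwards [h, hcons.ae_mem_imp_frequently_image_mem hA.nullMeasurableSet] with x hx h' hxA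
    exact hx (mem_limsup_iff_frequently_mem.2 (h' hxA))

/-- A `σ`-finite measure dominating a `σ`-finite measure differs from it by a measure. -/
theorem exists_add_eq_of_le {mu nu : Measure X} [SigmaFinite nu] (h : mu ≤ nu) :
    ∃ d : Measure X, mu + d = nu := by
  have : SigmaFinite mu := Measure.sigmaFinite_of_le nu h
  have hle := Measure.rnDeriv_le_one_of_le h
  refine ⟨nu.withDensity (1 - mu.rnDeriv nu), ?_⟩
  conv_lhs =>
    enter [1]
    rw [← Measure.withDensity_rnDeriv_eq mu nu (Measure.absolutelyContinuous_of_le h)]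
  rw [← withDensity_add_left (Measure.measurable_rnDeriv mu nu)]
  conv_rhs => rw [← withDensity_one (μ := nu)]
  refine withDensity_congr_ae ?_
  filter_upwards [hle] with x hx
  exact add_tsub_cancel_of_le hx

/-- A superinvariant `σ`-finite measure, absolutely continuous with respect to a conservative
measure, is invariant. -/
theorem map_eq_of_map_le (hcons : Conservative f lam) {nu : Measure X} [SigmaFinite nu]
    (hnu : nu ≪ lam) (hle : nu.map f ≤ nu) : nu.map f = nu := by
  have hf := hcons.measurable
  obtain ⟨d, hd⟩ := exists_add_eq_of_le hle
  have hdnu : d ≤ nu := by rw [← hd]; exact Measure.le_add_left le_rfl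
  have hfin : ∀ A, MeasurableSet A → nu A < ⊤ → d A = 0 := by
    intro A hA hAfin
    by_contra h0
    -- Telescoping `nu = nu.map f + d` bounds every partial sum by `nu A`.
    have hsum : ∀ n, ∑ k ∈ Finset.range n, d (f^[k] ⁻¹' A) + nu (f^[n] ⁻¹' A) = nu A := by
      intro n
      induction n with
      | zero => simp
      | succ n ih =>
        rw [← ih, Finset.sum_range_succ, add_assoc]
        congr 1
        conv_rhs => rw [← hd]
        rw [Measure.add_apply, Measure.map_apply hf (hf.iterate n hA), ← preimage_comp,
          ← Function.iterate_succ, add_comm]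
    have htop := tsum_measure_preimage_iterate_eq_top hcons
      ((Measure.absolutelyContinuous_of_le hdnu).trans hnu) hA h0
    refine (htop ▸ ENNReal.tsum_le_of_sum_range_le (c := nu A) fun n => ?_).not_gt hAfin
    rw [← hsum n]
    exact le_self_add
  have hd0 : d = 0 := by
    rw [← Measure.measure_univ_eq_zero, ← iUnion_spanningSets nu, measure_iUnion_null_iff]
    exact fun n => hfin _ (measurableSet_spanningSets nu n) (measure_spanningSets_lt_top nu n)
  simpa [hd0] using hd

end Recurrence

/-! ### Setwise limits of dominated measures. -/

section UltraLimit

variable {X ι : Type*} [MeasurableSpace X]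

/-- Measures dominated by a fixed finite measure converge setwise along any ultrafilter. -/
theorem exists_measure_tendsto_of_le (U : Ultrafilter ι) (mu : ι → Measure X)
    (rho : Measure X) [IsFiniteMeasure rho] (h : ∀ᶠ i in (U : Filter ι), mu i ≤ rho) :
    ∃ nu : Measure X, nu ≤ rho ∧
      ∀ A, MeasurableSet A → Tendsto (fun i => mu i A) U (𝓝 (nu A)) := by
  have hlim : ∀ A : Set X, ∃ a : ℝ≥0∞, Tendsto (fun i => mu i A) U (𝓝 a) := fun A => by
    obtain ⟨a, -, ha⟩ := isCompact_univ.ultrafilter_le_nhds (U.map fun i => mu i A) (by simp)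
    exact ⟨a, ha⟩
  choose m hm using hlim
  have hmle : ∀ A, m A ≤ rho A := fun A =>
    le_of_tendsto (hm A) (h.mono fun i hi => hi A)
  have hfin : ∀ A, m A ≠ ⊤ := fun A => ((hmle A).trans_lt (measure_lt_top rho A)).ne
  have hadd : ∀ s : ℕ → Set X, (∀ i, MeasurableSet (s i)) → Pairwise (Function.onFun Disjoint s) →
      m (⋃ i, s i) = ∑' i, m (s i) := by
    intro s hs hd
    have hsumr : ∑' j, rho (s j) ≠ ⊤ := by
      rw [← measure_iUnion hd hs]; exact measure_ne_top _ _
    have hsumm : ∑' j, m (s j) ≠ ⊤ :=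
      ne_top_of_le_ne_top hsumr (ENNReal.tsum_le_tsum fun j => hmle _)
    -- Countable additivity survives the limit by dominated convergence over `j`; this is where
    -- finiteness of `rho` enters.
    have key : Tendsto (fun i => ∑' j, (mu i (s j)).toReal) U (𝓝 (∑' j, (m (s j)).toReal)) := by
      refine tendsto_tsum_of_dominated_convergence (bound := fun j => (rho (s j)).toReal)
        (ENNReal.summable_toReal hsumr) (fun j => ?_) ?_
      · exact (ENNReal.tendsto_toReal (hfin _)).comp (hm (s j))
      · filter_upwards [h] with i hi j
        rw [Real.norm_of_nonneg ENNReal.toReal_nonneg]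
        exact ENNReal.toReal_mono (measure_ne_top _ _) (hi _)
    have key' : Tendsto (fun i => ∑' j, (mu i (s j)).toReal) U (𝓝 (m (⋃ i, s i)).toReal) := by
      refine ((ENNReal.tendsto_toReal (hfin _)).comp (hm (⋃ i, s i))).congr' ?_
      filter_upwards [h] with i hi
      rw [Function.comp_apply, measure_iUnion hd hs, ENNReal.tsum_toReal_eq]
      exact fun j => ((hi _).trans_lt (measure_lt_top rho _)).ne
    have := tendsto_nhds_unique key' key
    rw [← ENNReal.tsum_toReal_eq fun j => hfin _] at this
    exact (ENNReal.toReal_eq_toReal_iff' (hfin _) hsumm).1 this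
  have hempty : m ∅ = 0 := le_antisymm ((hmle ∅).trans (by simp)) zero_le
  let nu : Measure X := Measure.ofMeasurable (fun A _ => m A) hempty fun s hs hd => hadd s hs hd
  have hnu : ∀ A, MeasurableSet A → nu A = m A := fun A hA => Measure.ofMeasurable_apply A hA
  refine ⟨nu, Measure.le_iff.2 fun A hA => (hnu A hA).trans_le (hmle A), fun A hA => ?_⟩
  rw [hnu A hA]
  exact hm A

end UltraLimit

/-! ### Normalised sums of push-forwards and their limit. -/

section Birkhoff

variable {X : Type*} [MeasurableSpace X] {lam : Measure X} {f : X → X}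

/-- The sum of the push-forwards of a measure under the first `N` iterates of a map. -/
noncomputable def iterateSum (lam : Measure X) (f : X → X) (N : ℕ) : Measure X :=
  ∑ n ∈ Finset.range N, lam.map f^[n]

theorem iterateSum_apply (hf : Measurable f) (N : ℕ) {A : Set X} (hA : MeasurableSet A) :
    iterateSum lam f N A = ∑ n ∈ Finset.range N, lam (f^[n] ⁻¹' A) := by
  rw [iterateSum, Measure.finsetSum_apply]
  exact Finset.sum_congr rfl fun n _ => Measure.map_apply (hf.iterate n) hA

/-- The shift brings in at most `k` new terms, each at most 1. -/
theorem sum_range_shift_le [IsProbabilityMeasure lam] (N k : ℕ) (A : Set X) :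
    ∑ n ∈ Finset.range N, lam (f^[n + k] ⁻¹' A) ≤
      ∑ n ∈ Finset.range N, lam (f^[n] ⁻¹' A) + k := by
  calc ∑ n ∈ Finset.range N, lam (f^[n + k] ⁻¹' A)
      ≤ ∑ n ∈ Finset.range (N + k), lam (f^[n] ⁻¹' A) := by
        rw [add_comm N k, Finset.sum_range_add]
        simp_rw [add_comm k]
        exact le_add_self
    _ = ∑ n ∈ Finset.range N, lam (f^[n] ⁻¹' A) +
          ∑ n ∈ Finset.range k, lam (f^[N + n] ⁻¹' A) := Finset.sum_range_add _ _ _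
    _ ≤ _ := by
        gcongr
        exact (Finset.sum_le_card_nsmul _ _ 1 fun n _ => prob_le_one).trans (by simp)

theorem iterateSum_preimage_le [IsProbabilityMeasure lam] (hf : Measurable f) (N : ℕ)
    {A : Set X} (hA : MeasurableSet A) :
    iterateSum lam f N (f ⁻¹' A) ≤ iterateSum lam f N A + 1 := by
  rw [iterateSum_apply hf N hA, iterateSum_apply hf N (hf hA)]
  simpa only [Function.iterate_succ', preimage_comp, Nat.cast_one] using
    sum_range_shift_le (lam := lam) (f := f) N 1 A

theorem iterateSum_ne_top [IsProbabilityMeasure lam] (hf : Measurable f) (N : ℕ)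
    {A : Set X} (hA : MeasurableSet A) : iterateSum lam f N A ≠ ⊤ := by
  rw [iterateSum_apply hf N hA]
  exact ENNReal.sum_ne_top.2 fun n _ => measure_ne_top _ _

theorem tendsto_iterateSum_atTop (hcons : Conservative f lam) {A : Set X} (hA : MeasurableSet A)
    (h0 : lam A ≠ 0) : Tendsto (fun N => iterateSum lam f N A) atTop (𝓝 ⊤) := by
  rw [← tsum_measure_preimage_iterate_eq_top hcons Measure.AbsolutelyContinuous.rfl hA h0]
  simp_rw [fun N => iterateSum_apply (lam := lam) hcons.measurable N hA]
  exact ENNReal.tendsto_nat_tsum _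

/-- The bounded distortion condition, in multiplicative form with values in `ℝ≥0∞`. -/
theorem CondM2.exists_bound [IsProbabilityMeasure lam] (hf : Measurable f) {I : Set X}
    (hI : MeasurableSet I) (hpos : 0 < lam I) {K : ℝ} (hK : 0 < K) (h : CondM2 lam f lam I K) :
    ∃ C : ℝ≥0, ∀ n, ∀ A, MeasurableSet A → A ⊆ I →
      lam (f^[n] ⁻¹' A) ≤ C * lam (f^[n] ⁻¹' I) * lam A ∧
      lam (f^[n] ⁻¹' I) * lam A ≤ C * lam (f^[n] ⁻¹' A) := by
  have hIr : 0 < lam.real I := ENNReal.toReal_pos hpos.ne' (measure_ne_top _ _)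
  -- The first entry serves the upper bound, the second the lower one.
  refine ⟨Real.toNNReal (max (K / lam.real I) (K * lam.real I)), fun n A hA hAI => ?_⟩
  obtain ⟨hp, -, hd⟩ := h n
  obtain ⟨h1, h2⟩ := hd A hA hAI
  rw [map_measureReal_apply (hf.iterate n) hA, map_measureReal_apply (hf.iterate n) hI] at h1 h2
  have hp' : 0 < lam.real (f^[n] ⁻¹' I) := ENNReal.toReal_pos hp.ne' (measure_ne_top _ _)
  have hmax : 0 ≤ max (K / lam.real I) (K * lam.real I) := le_max_of_le_left (by positivity)
  rw [div_le_iff₀ hp'] at h2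
  rw [le_div_iff₀ hp'] at h1
  have e : ∀ s : Set X, lam s = ENNReal.ofReal (lam.real s) := fun s => by simp
  constructor
  · rw [e (f^[n] ⁻¹' A), e (f^[n] ⁻¹' I), e A, ← ENNReal.ofReal, ← ENNReal.ofReal_mul hmax,
      ← ENNReal.ofReal_mul (by positivity)]
    refine ENNReal.ofReal_le_ofReal (h2.trans ?_)
    calc K * (lam.real A / lam.real I) * lam.real (f^[n] ⁻¹' I)
        = K / lam.real I * lam.real (f^[n] ⁻¹' I) * lam.real A := by ring
      _ ≤ _ := by gcongr; exact le_max_left _ _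
  · rw [e (f^[n] ⁻¹' A), e (f^[n] ⁻¹' I), e A, ← ENNReal.ofReal, ← ENNReal.ofReal_mul hmax,
      ← ENNReal.ofReal_mul (by positivity)]
    refine ENNReal.ofReal_le_ofReal ?_
    calc lam.real (f^[n] ⁻¹' I) * lam.real A
        = K * lam.real I * (1 / K * (lam.real A / lam.real I) * lam.real (f^[n] ⁻¹' I)) := by
          field_simp
      _ ≤ K * lam.real I * lam.real (f^[n] ⁻¹' A) := by gcongr
      _ ≤ _ := by gcongr; exact le_max_right _ _

/-- On a set of bounded distortion, the sums of push-forwards are bounded by `lam`, up to a constant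
and the mass that they give to a reference set. -/
theorem exists_iterateSum_le [IsProbabilityMeasure lam] (hcons : Conservative f lam)
    (herg : QuasiErgodic f lam) {I J : Set X} (hI : MeasurableSet I) (hI0 : lam I ≠ 0)
    (hJ : MeasurableSet J) (hJ0 : 0 < lam J) {K : ℝ} (hK : 0 < K) (h : CondM2 lam f lam J K) :
    ∃ C : ℝ≥0, ∀ N, 1 ≤ N → ∀ A, MeasurableSet A → A ⊆ J →
      iterateSum lam f N A ≤ C * iterateSum lam f N I * lam A := by
  have hf := hcons.measurable
  obtain ⟨C, hC⟩ := h.exists_bound hf hJ hJ0 hK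
  obtain ⟨k, hk⟩ : ∃ k, lam (J ∩ f^[k] ⁻¹' I) ≠ 0 := by
    by_contra! hnull
    refine hJ0.ne' (measure_mono_null_ae ?_ (measure_iUnion_null hnull))
    filter_upwards [ae_exists_iterate_mem hcons herg hI hI0] with x ⟨n, hn⟩ hxJ
    exact mem_iUnion.2 ⟨n, hxJ, hn⟩
  set B := J ∩ f^[k] ⁻¹' I
  have hB : MeasurableSet B := hJ.inter (hf.iterate k hI)
  have hBtop : lam B ≠ ⊤ := measure_ne_top _ _
  -- Distortion compares `J` with `B`, and `B` lies in `I` after `k` more steps.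
  have hbound : ∀ n, lam (f^[n] ⁻¹' J) ≤ C / lam B * lam (f^[n + k] ⁻¹' I) := fun n => by
    rw [← ENNReal.mul_div_right_comm, ENNReal.le_div_iff_mul_le (.inl hk) (.inl hBtop)]
    refine ((hC n B hB inter_subset_left).2).trans ?_
    gcongr
    rw [add_comm n k, Function.iterate_add, preimage_comp]
    exact preimage_mono inter_subset_right
  have hcoef : (C : ℝ≥0∞) * (C / lam B) * (1 + k / lam I) ≠ ⊤ := by
    have h1 : (C : ℝ≥0∞) / lam B ≠ ⊤ := ENNReal.div_ne_top (by simp) hk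
    have h2 : (k : ℝ≥0∞) / lam I ≠ ⊤ := ENNReal.div_ne_top (by simp) hI0
    finiteness
  refine ⟨((C : ℝ≥0∞) * (C / lam B) * (1 + k / lam I)).toNNReal, fun N hN A hA hAJ => ?_⟩
  rw [ENNReal.coe_toNNReal hcoef]
  have hSI : lam I ≤ iterateSum lam f N I := by
    rw [iterateSum_apply hf N hI]
    exact Finset.single_le_sum (f := fun n => lam (f^[n] ⁻¹' I)) (fun _ _ => zero_le)
      (Finset.mem_range.2 hN)
  -- The additive error `k` becomes multiplicative, as `S N I ≥ lam I` once `N ≥ 1`.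
  have hkI : (k : ℝ≥0∞) ≤ k / lam I * iterateSum lam f N I := by
    calc (k : ℝ≥0∞) = k / lam I * lam I := (ENNReal.div_mul_cancel hI0 (measure_ne_top _ _)).symm
      _ ≤ _ := by gcongr
  calc iterateSum lam f N A
      ≤ ∑ n ∈ Finset.range N, C * lam (f^[n] ⁻¹' J) * lam A := by
        rw [iterateSum_apply hf N hA]
        exact Finset.sum_le_sum fun n _ => (hC n A hA hAJ).1
    _ ≤ ∑ n ∈ Finset.range N, C * (C / lam B * lam (f^[n + k] ⁻¹' I)) * lam A := by
        gcongr with n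
        exact hbound n
    _ = C * (C / lam B) * (∑ n ∈ Finset.range N, lam (f^[n + k] ⁻¹' I)) * lam A := by
        rw [Finset.mul_sum, Finset.sum_mul]
        simp_rw [mul_assoc]
    _ ≤ C * (C / lam B) * (iterateSum lam f N I + k) * lam A := by
        gcongr
        rw [iterateSum_apply hf N hI]
        exact sum_range_shift_le N k I
    _ ≤ C * (C / lam B) * (iterateSum lam f N I + k / lam I * iterateSum lam f N I) * lam A := by
        gcongr
    _ = _ := by ring

/-- A map with bounded distortion on the elements of a `lam`-partition has a nonzero `σ`-finite
superinvariant measure, absolutely continuous with respect to `lam`. -/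
theorem exists_superinvariant [TopologicalSpace X] [IsProbabilityMeasure lam]
    (hcons : Conservative f lam) (herg : QuasiErgodic f lam) {G : Set (Set X)}
    (hG : IsLambdaPartition lam G) (hM : lam ∈ measureClass lam G f) :
    ∃ nu : Measure X, SigmaFinite nu ∧ nu ≠ 0 ∧ nu ≪ lam ∧ nu.map f ≤ nu := by
  have hf := hcons.measurable
  have : Countable G := hG.countable.to_subtype
  obtain ⟨I, hIG⟩ : G.Nonempty := by
    by_contra hne
    have := hG.null_compl
    simp [not_nonempty_iff_eq_empty.1 hne] at this
  have hI := hG.measurableSet I hIG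
  have hI0 : lam I ≠ 0 := (hG.pos I hIG).ne'
  let U : Ultrafilter ℕ := hyperfilter ℕ
  have hU : (U : Filter ℕ) ≤ atTop := Nat.hyperfilter_le_atTop
  let S : ℕ → Measure X := iterateSum lam f
  let mu : ℕ → Measure X := fun N => (S N I)⁻¹ • S N
  have hS0 : ∀ᶠ N in (U : Filter ℕ), S N I ≠ 0 :=
    (((tendsto_iterateSum_atTop hcons hI hI0).mono_left hU).eventually_ne ENNReal.top_ne_zero)
  have hStop : ∀ N, S N I ≠ ⊤ := fun N => iterateSum_ne_top hf N hI
  have hdom : ∀ J : G, ∃ C : ℝ≥0, ∀ᶠ N in (U : Filter ℕ), (mu N).restrict J ≤ C • lam := by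
    intro J
    obtain ⟨K, hK, -, hJM⟩ := hM.2 J J.2
    obtain ⟨C, hC⟩ := exists_iterateSum_le hcons herg hI hI0 (hG.measurableSet J J.2)
      (hG.pos J J.2) hK hJM
    refine ⟨C, ?_⟩
    filter_upwards [hU (eventually_ge_atTop 1), hS0] with N hN hN0
    refine Measure.le_iff.2 fun A hA => ?_
    rw [Measure.restrict_apply hA]
    calc (S N I)⁻¹ * S N (A ∩ J)
        ≤ (S N I)⁻¹ * (C * S N I * lam (A ∩ J)) := by
          gcongr
          exact hC N hN _ (hA.inter (hG.measurableSet J J.2)) inter_subset_right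
      _ = (S N I)⁻¹ * S N I * (C * lam (A ∩ J)) := by ring
      _ = C * lam (A ∩ J) := by rw [ENNReal.inv_mul_cancel hN0 (hStop N), one_mul]
      _ ≤ C * lam A := by gcongr; exact inter_subset_left
  choose C hC using hdom
  choose nuJ hnuJle hnuJ using fun J : G => exists_measure_tendsto_of_le U _ (C J • lam) (hC J)
  have hlim : ∀ (J : G) (A : Set X), MeasurableSet A →
      Tendsto (fun N => mu N (A ∩ J)) U (𝓝 (nuJ J A)) := fun J A hA =>
    (hnuJ J A hA).congr fun N => Measure.restrict_apply hA
  have hmono : ∀ (F : Finset G) (A : Set X), MeasurableSet A → ∀ N,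
      ∑ J ∈ F, mu N (A ∩ J) ≤ mu N A := by
    intro F A hA N
    rw [← measure_biUnion_finset]
    · exact measure_mono (iUnion₂_subset fun _ _ => inter_subset_left)
    · intro J _ J' _ hne
      exact (hG.pairwiseDisjoint J J.2 J' J'.2 (Subtype.coe_ne_coe.2 hne)).mono
        inter_subset_right inter_subset_right
    · exact fun J _ => hA.inter (hG.measurableSet J J.2)
  let nu : Measure X := Measure.sum nuJ
  have hnuac : nu ≪ lam := Measure.absolutelyContinuous_sum_left fun J =>
    (Measure.absolutelyContinuous_of_le (hnuJle J)).trans (Measure.smul_absolutelyContinuous)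
  -- A Fatou-type bound: only finitely many `J` pass to the limit at once, hence an inequality.
  have hnule : ∀ (A : Set X), MeasurableSet A → ∀ a : ℝ≥0∞, Tendsto (fun N => mu N A) U (𝓝 a) →
      nu A ≤ a := by
    intro A hA a ha
    rw [Measure.sum_apply _ hA]
    refine ENNReal.summable.tsum_le_of_sum_le fun F => ?_
    exact le_of_tendsto_of_tendsto (tendsto_finsetSum F fun J _ => hlim J A hA) ha
      (Eventually.of_forall (hmono F A hA))
  have hlocal : ∀ (J : G) (A : Set X), MeasurableSet A → A ⊆ J →
      Tendsto (fun N => mu N A) U (𝓝 (nuJ J A)) := fun J A hA hAJ => by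
    simpa only [inter_eq_left.2 hAJ] using hlim J A hA
  have hpre : ∀ (J : G) (A : Set X), MeasurableSet A → A ⊆ J → nu (f ⁻¹' A) ≤ nu A := by
    intro J A hA hAJ
    obtain ⟨a, -, ha⟩ := isCompact_univ.ultrafilter_le_nhds (U.map fun N => mu N (f ⁻¹' A)) (by simp)
    refine (hnule _ (hf hA) a ha).trans ((?_ : a ≤ nuJ J A).trans (Measure.le_sum nuJ J A))
    -- The boundary error 1, once normalised, vanishes because conservativity makes `S N I` diverge.
    have h1 : Tendsto (fun N => mu N A + (S N I)⁻¹) U (𝓝 (nuJ J A + 0)) := by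
      refine (hlocal J A hA hAJ).add ?_
      rw [← ENNReal.inv_top]
      exact tendsto_inv_iff.2 ((tendsto_iterateSum_atTop hcons hI hI0).mono_left hU)
    rw [add_zero] at h1
    refine le_of_tendsto_of_tendsto ha h1 (Eventually.of_forall fun N => ?_)
    calc (S N I)⁻¹ * S N (f ⁻¹' A) ≤ (S N I)⁻¹ * (S N A + 1) := by
          gcongr
          exact iterateSum_preimage_le hf N hA
      _ = _ := by rw [mul_add, mul_one]; rfl
  have hnuI : nu I = 1 := by
    have h1 : Tendsto (fun N => mu N I) U (𝓝 1) := by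
      refine tendsto_const_nhds.congr' ?_
      filter_upwards [hS0] with N hN
      exact (ENNReal.inv_mul_cancel hN (hStop N)).symm
    refine le_antisymm (hnule I hI 1 h1) ?_
    rw [tendsto_nhds_unique h1 (hlocal ⟨I, hIG⟩ I hI subset_rfl)]
    exact Measure.le_sum nuJ ⟨I, hIG⟩ I
  have hcompl : nu (⋃₀ G)ᶜ = 0 := hnuac hG.null_compl
  refine ⟨nu, ?_, ?_, hnuac, Measure.le_iff.2 fun A hA => ?_⟩
  · refine Measure.sigmaFinite_of_countable (S := insert (⋃₀ G)ᶜ G) (hG.countable.insert _) ?_ ?_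
    · rintro s (rfl | hs)
      · simp [hcompl]
      · refine (hnule s (hG.measurableSet s hs) _
          (hlocal ⟨s, hs⟩ s (hG.measurableSet s hs) subset_rfl)).trans_lt ?_
        exact (hnuJle _ s).trans_lt (measure_lt_top _ _)
    · rw [sUnion_insert, compl_union_self]
  · intro h0
    simp [h0] at hnuI
  · have hmapac : nu.map f ≪ lam :=
      (hnuac.map hf).trans hcons.toQuasiMeasurePreserving.absolutelyContinuous
    have hdecomp : A ≤ᵐ[lam] ⋃ J : G, A ∩ J := by
      filter_upwards [measure_eq_zero_iff_ae_notMem.1 hG.null_compl] with x hx hxA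
      obtain ⟨J, hJ, hxJ⟩ := mem_sUnion.1 (notMem_compl_iff.1 hx)
      exact mem_iUnion.2 ⟨⟨J, hJ⟩, hxA, hxJ⟩
    have hAJ : ∀ J : G, MeasurableSet (A ∩ J) := fun J => hA.inter (hG.measurableSet J J.2)
    calc nu.map f A ≤ nu.map f (⋃ J : G, A ∩ J) := measure_mono_ae (hmapac.ae_le hdecomp)
      _ ≤ ∑' J : G, nu.map f (A ∩ J) := measure_iUnion_le _
      _ ≤ ∑' J : G, nu (A ∩ J) := by
          refine ENNReal.tsum_le_tsum fun J => ?_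
          rw [Measure.map_apply hf (hAJ J)]
          exact hpre J _ (hAJ J) inter_subset_right
      _ = nu (⋃ J : G, A ∩ J) := by
          refine (measure_iUnion (fun J J' hne => ?_) hAJ).symm
          exact (hG.pairwiseDisjoint J J.2 J' J'.2 (Subtype.coe_ne_coe.2 hne)).mono
            inter_subset_right inter_subset_right
      _ ≤ nu A := measure_mono (iUnion_subset fun _ => inter_subset_left)

end Birkhoff

end Acim

theorem theorem2p9 {X : Type*} [TopologicalSpace X] [SigmaCompactSpace X]
    [MeasurableSpace X] [BorelSpace X]
    (lam : MeasureTheory.Measure X) [MeasureTheory.IsProbabilityMeasure lam]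
    (f : X → X) (hf : Measurable f) (hqi : (lam.map f).AbsolutelyContinuous lam)
    (herg : QuasiErgodic f lam) (hcons : MeasureTheory.Conservative f lam)
    (hG : ∃ G : Set (Set X), Acim.IsLambdaPartition lam G ∧ lam ∈ Acim.measureClass lam G f) :
    ∃ nu : MeasureTheory.Measure X, MeasureTheory.SigmaFinite nu ∧ nu ≠ 0 ∧
      nu.AbsolutelyContinuous lam ∧ MeasureTheory.MeasurePreserving f nu nu := by
  obtain ⟨G, hpart, hM⟩ := hG
  obtain ⟨nu, hsf, h0, hac, hle⟩ := Acim.exists_superinvariant hcons herg hpart hM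
  exact ⟨nu, hsf, h0, hac, hf, Acim.map_eq_of_map_le hcons hac hle⟩
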